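/- Let $0\le m<n$ be integers, let $K>0$ and $\alpha\ge 0$ be real, and let $z_1,\dots,z_m\in\mathbb{C}$ be closed under complex conjugation (counted with multiplicity). For $p=(p_1,\dots,p_n)\in\mathbb{C}^n$ consider the closed-loop transfer function $$H(s)=K\,\frac{\prod_{i=1}^m (s-z_i)}{\prod_{i=1}^n (s-p_i)} .$$ Call $H$ stable if $\operatorname{Re}(p_i)<0$ for all $i$; call it PIR (positive impulse response) if its inverse Laplace transform $h$ satisfies $h(t)\ge 0$ for all $t\ge 0$ (so in particular $h$ is real-valued); and let $\sigma(H)=\max_i \operatorname{Re}(p_i)$ be its decay rate. Say that there are no zero-pole cancellations if $p_i\neq z_j$ for all $i,j$. Write $$B'(s)=K\prod_{i=1}^m (s-z_i-\alpha)=b'_0s^n+b'_1s^{n-1}+\dots+b'_n ,\qquad \tilde{B'}(s)=\sum_{i=1}^n \frac{b'_i\, s^{n-i}}{(i-1)!}.$$ Then there exist poles $p\in\mathbb{C}^n$ without zero-pole cancellations such that $H$ is stable and PIR with $\sigma(H)<-\alpha$ if and only if the polynomial $\tilde{B'}$ has no real non-negative roots. The same equivalence holds if zero-pole cancellations are allowed.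 -/

import Mathlib

open Polynomial

noncomputable section

namespace MonotonicTracking

/-- The family `z` is closed under complex conjugation, counted with multiplicity: the polynomial
with these roots is real. -/
def ConjClosed {m : ℕ} (z : Fin m → ℂ) : Prop :=
  ∃ e : Equiv.Perm (Fin m), ∀ i, z (e i) = (starRingEnd ℂ) (z i)

/-- The closed-loop transfer function `H(s) = K ∏ (s - z i) / ∏ (s - p i)`. -/
def transferFunction {m n : ℕ} (K : ℝ) (z : Fin m → ℂ) (p : Fin n → ℂ) (s : ℂ) : ℂ :=
  (K : ℂ) * (∏ i, (s - z i)) / ∏ i, (s - p i)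

/-- The continuous function `h` on `[0, ∞)` is the inverse Laplace transform of `H`: on some right
half-plane the Laplace integral of `h` converges absolutely and equals `H`. -/
def IsInverseLaplace (h : ℝ → ℝ) (H : ℂ → ℂ) : Prop :=
  ContinuousOn h (Set.Ici 0) ∧
    ∃ c : ℝ, ∀ s : ℂ, c < s.re →
      MeasureTheory.IntegrableOn (fun t : ℝ => Complex.exp (-s * (t : ℂ)) * (h t : ℂ))
        (Set.Ioi 0) ∧
      ∫ t in Set.Ioi (0 : ℝ), Complex.exp (-s * (t : ℂ)) * (h t : ℂ) = H s

/-- `H` is a positive-impulse-response (PIR) transfer function. -/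
def IsPIR (H : ℂ → ℂ) : Prop :=
  ∃ h : ℝ → ℝ, IsInverseLaplace h H ∧ ∀ t : ℝ, 0 ≤ t → 0 ≤ h t

/-- All closed-loop poles lie in the open left half-plane. -/
def IsStable {n : ℕ} (p : Fin n → ℂ) : Prop := ∀ i, (p i).re < 0

/-- The decay rate `max_i Re (p i)` (used for `n ≥ 1` only). -/
def decayRate {n : ℕ} (p : Fin n → ℂ) : ℝ := ⨆ i, (p i).re

/-- The poles `p` render the closed loop with zeros `z` and gain `K` stable and PIR. -/
def IsSolution {m n : ℕ} (K : ℝ) (z : Fin m → ℂ) (p : Fin n → ℂ) : Prop :=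
  IsStable p ∧ IsPIR (transferFunction K z p)

/-- There is no zero-pole cancellation. -/
def NoCancellation {m n : ℕ} (z : Fin m → ℂ) (p : Fin n → ℂ) : Prop :=
  ∀ i j, p i ≠ z j

/-- `B'(s) = K ∏ (s - z i - α)`. -/
def shiftedNumerator {m : ℕ} (K : ℝ) (z : Fin m → ℂ) (α : ℝ) : ℂ[X] :=
  C (K : ℂ) * ∏ i, (X - C (z i) - C (α : ℂ))

/-- For `B(s) = b₀ sⁿ + b₁ sⁿ⁻¹ + ⋯ + bₙ`, the polynomial
`∑_{i=1}^{n} bᵢ sⁿ⁻ⁱ / (i - 1)!`; here `bᵢ = B.coeff (n - i)`. -/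
def modifiedPolynomial (n : ℕ) (B : ℂ[X]) : ℂ[X] :=
  ∑ i ∈ Finset.Icc 1 n, C (B.coeff (n - i) / (Nat.factorial (i - 1) : ℂ)) * X ^ (n - i)

/-- `P` has a real non-negative root. -/
def HasNonnegRealRoot (P : ℂ[X]) : Prop := ∃ x : ℝ, 0 ≤ x ∧ P.IsRoot (x : ℂ)

end MonotonicTracking

end

namespace MonotonicTracking

open MeasureTheory Set

/-! Let `b` be the real polynomial `B'`. The function `polyImpulse n b`, inverse Laplace transform
of `b / sⁿ`, is a reversal of the modified polynomial: `x` corresponds to the time `t = 1 / x`, and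
`x = 0` to `t → ∞`. So the root condition says that placing all poles at `-α` gives a response that
is positive for `t > 0` and has the largest possible growth, after removal of the factor `exp (-α
t)`.

Sufficiency: this positivity is open under small translations of `b`
(`eventually_modifiedEval_taylor_pos`), so all poles can be put at one point slightly to the left of
`-α`, chosen to miss the zeros.

Necessity (`modifiedEval_pos_of_nonneg_impulse`): `exp (α t) h(t)` has transform `b / A` with `A`
monic, real and Hurwitz, hence with nonnegative coefficients. Since `b / sⁿ = (b / A) * (A / sⁿ)`,
`polyImpulse n b` is a nonnegative function plus its convolution with a nonnegative polynomial of
degree `n - 1`, which forces strict positivity and growth of order `t ^ (n - 1)`. Cancellations play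
no role here, so both equivalences follow together. -/

/-! ### Laplace transforms: operations, powers, injectivity. -/

/-- The Laplace integral of `f` converges absolutely at `s`, with value `v`. -/
def HasLaplaceAt (f : ℝ → ℝ) (s v : ℂ) : Prop :=
  IntegrableOn (fun t : ℝ => Complex.exp (-s * (t : ℂ)) * (f t : ℂ)) (Ioi 0) ∧
    ∫ t in Ioi (0 : ℝ), Complex.exp (-s * (t : ℂ)) * (f t : ℂ) = v

namespace HasLaplaceAt

variable {f g : ℝ → ℝ} {s v w : ℂ}

theorem add (hf : HasLaplaceAt f s v) (hg : HasLaplaceAt g s w) :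
    HasLaplaceAt (fun t => f t + g t) s (v + w) := by
  have e : (fun t : ℝ => Complex.exp (-s * (t : ℂ)) * ((f t + g t : ℝ) : ℂ)) =
      fun t : ℝ => Complex.exp (-s * (t : ℂ)) * (f t : ℂ) +
        Complex.exp (-s * (t : ℂ)) * (g t : ℂ) := by
    funext t; push_cast; ring
  unfold HasLaplaceAt
  rw [e]
  exact ⟨hf.1.add hg.1, by rw [integral_add hf.1 hg.1, hf.2, hg.2]⟩

theorem const_mul (c : ℝ) (hf : HasLaplaceAt f s v) :
    HasLaplaceAt (fun t => c * f t) s (c * v) := by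
  have e : (fun t : ℝ => Complex.exp (-s * (t : ℂ)) * ((c * f t : ℝ) : ℂ)) =
      fun t : ℝ => (c : ℂ) * (Complex.exp (-s * (t : ℂ)) * (f t : ℂ)) := by
    funext t; push_cast; ring
  unfold HasLaplaceAt
  rw [e]
  exact ⟨hf.1.const_mul _, by rw [integral_const_mul, hf.2]⟩

theorem sub (hf : HasLaplaceAt f s v) (hg : HasLaplaceAt g s w) :
    HasLaplaceAt (fun t => f t - g t) s (v - w) := by
  have := hf.add (hg.const_mul (-1))
  convert this using 1
  · funext t; ring
  · push_cast; ring

theorem zero : HasLaplaceAt (fun _ => 0) s 0 := by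
  simp [HasLaplaceAt]

theorem sum {ι : Type*} (T : Finset ι) {F : ι → ℝ → ℝ} {V : ι → ℂ}
    (h : ∀ i ∈ T, HasLaplaceAt (F i) s (V i)) :
    HasLaplaceAt (fun t => ∑ i ∈ T, F i t) s (∑ i ∈ T, V i) := by
  classical
  induction T using Finset.induction_on with
  | empty => simpa using zero
  | insert a T ha ih =>
    simp only [Finset.sum_insert ha]
    exact (h a (by simp)).add (ih fun i hi => h i (by simp [hi]))

theorem exp_mul (a : ℝ) (hf : HasLaplaceAt f s v) :
    HasLaplaceAt (fun t => Real.exp (a * t) * f t) (s + a) v := by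
  have e : (fun t : ℝ => Complex.exp (-(s + a) * (t : ℂ)) * ((Real.exp (a * t) * f t : ℝ) : ℂ)) =
      fun t : ℝ => Complex.exp (-s * (t : ℂ)) * (f t : ℂ) := by
    funext t
    push_cast
    rw [← mul_assoc, ← Complex.exp_add]
    congr 2; ring
  unfold HasLaplaceAt
  rw [e]
  exact hf

theorem congr (hf : HasLaplaceAt f s v) (h : ∀ t, 0 < t → f t = g t) : HasLaplaceAt g s v := by
  have e : EqOn (fun t : ℝ => Complex.exp (-s * (t : ℂ)) * (f t : ℂ))
      (fun t : ℝ => Complex.exp (-s * (t : ℂ)) * (g t : ℂ)) (Ioi 0) := by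
    intro t ht
    simp [h t ht]
  exact ⟨hf.1.congr_fun e measurableSet_Ioi, by rw [← hf.2, setIntegral_congr_fun measurableSet_Ioi e]⟩

theorem convolution (hf : HasLaplaceAt f s v) (hg : HasLaplaceAt g s w) :
    HasLaplaceAt (fun t => ∫ u in (0 : ℝ)..t, f u * g (t - u)) s (v * w) := by
  have e : (fun t : ℝ => Complex.exp (-s * (t : ℂ)) *
      ((∫ u in (0 : ℝ)..t, f u * g (t - u) : ℝ) : ℂ)) =
      fun t : ℝ => ∫ u in (0 : ℝ)..t, (ContinuousLinearMap.mul ℝ ℂ)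
        (Complex.exp (-s * (u : ℂ)) * (f u : ℂ))
        (Complex.exp (-s * ((t - u : ℝ) : ℂ)) * (g (t - u) : ℂ)) := by
    funext t
    rw [← intervalIntegral.integral_ofReal, ← intervalIntegral.integral_const_mul]
    congr 1
    funext u
    simp only [ContinuousLinearMap.mul_apply']
    rw [show -s * (t : ℂ) = -s * (u : ℂ) + -s * ((t - u : ℝ) : ℂ) by push_cast; ring,
      Complex.exp_add]
    push_cast; ring
  unfold HasLaplaceAt
  rw [e]
  constructor
  · have := integrable_posConvolution hf.1 hg.1 (ContinuousLinearMap.mul ℝ ℂ)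
    rwa [posConvolution, integrable_indicator_iff measurableSet_Ioi] at this
  · rw [integral_posConvolution hf.1 hg.1, hf.2, hg.2]
    rfl

end HasLaplaceAt

theorem hasLaplaceAt_one {s : ℂ} (hs : 0 < s.re) : HasLaplaceAt (fun _ => 1) s (1 / s) := by
  have h : (-s).re < 0 := by simpa using hs
  constructor
  · simpa using integrableOn_exp_mul_complex_Ioi h 0
  · simpa using integral_exp_mul_complex_Ioi h 0

theorem hasLaplaceAt_pow_div_factorial {s : ℂ} (hs : 0 < s.re) (k : ℕ) :
    HasLaplaceAt (fun t => t ^ k / (k.factorial : ℝ)) s (1 / s ^ (k + 1)) := by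
  induction k with
  | zero => simpa using hasLaplaceAt_one hs
  | succ k ih =>
    have := ih.convolution (hasLaplaceAt_one hs)
    convert this using 1
    · funext t
      simp only [mul_one, intervalIntegral.integral_div, integral_pow, Nat.factorial_succ]
      push_cast
      field_simp
      simp
    · rw [pow_succ s (k + 1)]
      field_simp

/-- Injectivity of the Laplace transform on continuous functions. -/
theorem eq_zero_of_hasLaplaceAt_zero {f : ℝ → ℝ} {c : ℝ} (hf : ContinuousOn f (Ici 0))
    (h : ∀ s : ℂ, s.re = c → HasLaplaceAt f s 0) {t : ℝ} (ht : 0 < t) : f t = 0 := by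
  set F : ℝ → ℂ := indicator (Ioi 0) fun t : ℝ => Complex.exp (-(c : ℂ) * (t : ℂ)) * (f t : ℂ)
    with hF
  have hFi : Integrable F := by
    rw [hF, integrable_indicator_iff measurableSet_Ioi]
    exact (h c (by simp)).1
  -- The Fourier transform of `F` at `x` is the Laplace integral of `f` at `c + 2πix`; Fourier
  -- inversion at a continuity point then gives the claim.
  have hzero : FourierTransform.fourier F = 0 := by
    funext x
    rw [Real.fourier_real_eq_integral_exp_smul]
    have := (h (c + (2 * Real.pi * x : ℝ) * Complex.I) (by simp)).2
    rw [Pi.zero_apply, ← this, ← integral_indicator measurableSet_Ioi]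
    congr 1
    funext u
    simp only [hF, indicator_apply]
    split_ifs
    · rw [smul_eq_mul, ← mul_assoc, ← Complex.exp_add]
      congr 2
      push_cast; ring
    · simp
  have hcont : ContinuousAt F t := by
    have h1 : ContinuousAt (fun t : ℝ => Complex.exp (-(c : ℂ) * (t : ℂ)) * (f t : ℂ)) t := by
      have := hf.continuousAt (Ici_mem_nhds ht)
      fun_prop
    refine h1.congr ?_
    filter_upwards [Ioi_mem_nhds ht] with u hu
    simp only [hF, indicator_of_mem hu]
  have := hFi.fourierInv_fourier_eq (by rw [hzero]; exact integrable_zero _ _ _) hcont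
  rw [hzero] at this
  have h0 : F t = 0 := by
    rw [← this, Real.fourierInv_eq']
    simp
  simpa [hF, indicator_of_mem (mem_Ioi.2 ht), Complex.exp_ne_zero] using h0

/-! ### Polynomial impulse responses and the modified polynomial. -/

/-- The inverse Laplace transform of `P(s) / sⁿ` for a real polynomial `P` of degree less
than `n`. -/
noncomputable def polyImpulse (n : ℕ) (P : ℝ[X]) (t : ℝ) : ℝ :=
  ∑ k ∈ Finset.range n, P.coeff k * (t ^ (n - 1 - k) / ((n - 1 - k).factorial : ℝ))

/-- The function on `ℝ` given by `modifiedPolynomial` for a real polynomial. -/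
noncomputable def modifiedEval (n : ℕ) (P : ℝ[X]) (x : ℝ) : ℝ :=
  ∑ k ∈ Finset.range n, P.coeff k * (x ^ k / ((n - 1 - k).factorial : ℝ))

theorem continuous_polyImpulse (n : ℕ) (P : ℝ[X]) : Continuous (polyImpulse n P) := by
  unfold polyImpulse; fun_prop

theorem continuous_modifiedEval (n : ℕ) (P : ℝ[X]) : Continuous (modifiedEval n P) := by
  unfold modifiedEval; fun_prop

theorem modifiedEval_eq_polyImpulse {n : ℕ} (P : ℝ[X]) {x : ℝ} (hx : x ≠ 0) :
    modifiedEval n P x = x ^ (n - 1) * polyImpulse n P x⁻¹ := by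
  unfold modifiedEval polyImpulse
  rw [Finset.mul_sum]
  refine Finset.sum_congr rfl fun k hk => ?_
  have hk' : n - 1 = k + (n - 1 - k) := by
    have := Finset.mem_range.1 hk
    omega
  have e : x ^ (n - 1) = x ^ k * x ^ (n - 1 - k) := by rw [← pow_add, ← hk']
  rw [e, inv_pow]
  field_simp

theorem modifiedEval_zero {n : ℕ} (hn : 0 < n) (P : ℝ[X]) :
    modifiedEval n P 0 = P.coeff 0 / ((n - 1).factorial : ℝ) := by
  unfold modifiedEval
  rw [Finset.sum_eq_single_of_mem 0 (by simpa using hn)]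
  · simp [div_eq_mul_inv]
  · intro k _ hk
    simp [hk]

theorem eval_modifiedPolynomial (n : ℕ) (P : ℝ[X]) (x : ℝ) :
    (modifiedPolynomial n (P.map Complex.ofRealHom)).eval (x : ℂ) = (modifiedEval n P x : ℂ) := by
  unfold modifiedPolynomial modifiedEval
  rw [eval_finsetSum]
  push_cast
  refine Finset.sum_bij' (fun i _ => n - i) (fun k _ => n - k) ?_ ?_ ?_ ?_ ?_
  · intro i hi
    simp only [Finset.mem_Icc, Finset.mem_range] at *
    omega
  · intro i hi
    simp only [Finset.mem_Icc, Finset.mem_range] at *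
    omega
  · intro i hi
    simp only [Finset.mem_Icc] at hi
    omega
  · intro i hi
    simp only [Finset.mem_range] at hi
    omega
  · intro i hi
    simp only [Finset.mem_Icc] at hi
    have : n - 1 - (n - i) = i - 1 := by omega
    simp [this]
    ring

theorem hasNonnegRealRoot_modifiedPolynomial_iff (n : ℕ) (P : ℝ[X]) :
    HasNonnegRealRoot (modifiedPolynomial n (P.map Complex.ofRealHom)) ↔
      ∃ x : ℝ, 0 ≤ x ∧ modifiedEval n P x = 0 := by
  simp only [HasNonnegRealRoot, IsRoot.def, eval_modifiedPolynomial, Complex.ofReal_eq_zero]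

theorem hasLaplaceAt_polyImpulse {s : ℂ} (hs : 0 < s.re) (n : ℕ) (P : ℝ[X]) :
    HasLaplaceAt (polyImpulse n P) s ((∑ k ∈ Finset.range n, (P.coeff k : ℂ) * s ^ k) / s ^ n) := by
  have hs0 : s ≠ 0 := by rintro rfl; simp at hs
  have := HasLaplaceAt.sum (s := s) (Finset.range n) fun k _ =>
    (hasLaplaceAt_pow_div_factorial hs (n - 1 - k)).const_mul (P.coeff k)
  change HasLaplaceAt (fun t => ∑ k ∈ Finset.range n, _) s _
  convert this using 1
  rw [Finset.sum_div]
  refine Finset.sum_congr rfl fun k hk => ?_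
  have hk' : n = k + (n - 1 - k + 1) := by
    have := Finset.mem_range.1 hk
    omega
  have e : s ^ n = s ^ k * s ^ (n - 1 - k + 1) := by rw [← pow_add, ← hk']
  rw [e]
  field_simp

theorem hasLaplaceAt_polyImpulse_of_natDegree_lt {s : ℂ} (hs : 0 < s.re) {n : ℕ} {P : ℝ[X]}
    (hP : P.natDegree < n) :
    HasLaplaceAt (polyImpulse n P) s (P.eval₂ Complex.ofRealHom s / s ^ n) := by
  rw [eval₂_eq_sum_range' _ hP]
  exact hasLaplaceAt_polyImpulse hs n P

/-- The sum in `polyImpulse` stops short of the leading coefficient, whose contribution would be a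
Dirac mass at `0`; this accounts for the `- 1`. -/
theorem hasLaplaceAt_polyImpulse_of_monic {s : ℂ} (hs : 0 < s.re) {P : ℝ[X]} (hP : P.Monic) :
    HasLaplaceAt (polyImpulse P.natDegree P) s
      (P.eval₂ Complex.ofRealHom s / s ^ P.natDegree - 1) := by
  have hs0 : s ≠ 0 := by rintro rfl; simp at hs
  convert hasLaplaceAt_polyImpulse hs P.natDegree P using 1
  rw [eval₂_eq_sum_range, Finset.sum_range_succ]
  have : P.coeff P.natDegree = 1 := hP
  rw [this]
  field_simp
  simp

/-- A polynomial function vanishing on an interval has zero coefficients. -/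
theorem eq_zero_of_polyImpulse_eq_zero {n : ℕ} {P : ℝ[X]} (hP : P.natDegree < n) {T : ℝ}
    (hT : 0 < T) (h : ∀ t ∈ Ioo 0 T, polyImpulse n P t = 0) : P = 0 := by
  set Q : ℝ[X] := ∑ k ∈ Finset.range n, C (P.coeff k / ((n - 1 - k).factorial : ℝ)) * X ^ (n - 1 - k)
    with hQ
  have hev : ∀ t, Q.eval t = polyImpulse n P t := by
    intro t
    simp only [hQ, polyImpulse, eval_finsetSum, eval_mul, eval_C, eval_pow, eval_X]
    exact Finset.sum_congr rfl fun k _ => by ring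
  have hQ0 : Q = 0 := by
    refine Q.eq_zero_of_infinite_isRoot ((Ioo_infinite hT).mono fun t ht => ?_)
    simp [IsRoot.def, hev, h t ht]
  ext k
  rw [coeff_zero]
  by_cases hk : k < n
  · have h1 : Q.coeff (n - 1 - k) = P.coeff k / ((n - 1 - k).factorial : ℝ) := by
      rw [hQ, finsetSum_coeff, Finset.sum_eq_single_of_mem k (by simpa using hk)]
      · simp
      · intro j hj hjk
        have := Finset.mem_range.1 hj
        rw [coeff_C_mul, coeff_X_pow, if_neg (by omega), mul_zero]
    rw [hQ0, coeff_zero, eq_comm, div_eq_zero_iff] at h1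
    exact h1.resolve_right (by positivity)
  · exact coeff_eq_zero_of_natDegree_lt (by omega)

/-! ### Coefficients of Hurwitz polynomials. -/

theorem coeff_mul_nonneg {P Q : ℝ[X]} (hP : ∀ k, 0 ≤ P.coeff k) (hQ : ∀ k, 0 ≤ Q.coeff k) (k : ℕ) :
    0 ≤ (P * Q).coeff k := by
  rw [coeff_mul]
  exact Finset.sum_nonneg fun i _ => mul_nonneg (hP _) (hQ _)

/-- A monic real polynomial whose complex roots lie in the closed left half-plane has nonnegative
coefficients. -/
theorem coeff_nonneg_of_roots_re_nonpos {P : ℝ[X]} (hP : P.Monic)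
    (h : ∀ w : ℂ, aeval w P = 0 → w.re ≤ 0) (k : ℕ) : 0 ≤ P.coeff k := by
  induction hd : P.natDegree using Nat.strong_induction_on generalizing P k with
  | _ d ih =>
  -- It suffices to split off one real factor with nonnegative coefficients: linear for a real root,
  -- quadratic for a conjugate pair.
  have step : ∀ D : ℝ[X], D.Monic → 0 < D.natDegree → (∀ j, 0 ≤ D.coeff j) → D ∣ P →
      0 ≤ P.coeff k := by
    rintro D hD hD0 hDc ⟨Q, rfl⟩
    have hQ : Q.Monic := hD.of_mul_monic_left hP
    have hdeg := hD.natDegree_mul hQ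
    refine coeff_mul_nonneg hDc (fun j => ?_) k
    refine ih Q.natDegree (by omega) hQ (fun w hw => h w ?_) j rfl
    simp [hw]
  rcases Nat.eq_zero_or_pos d with h0 | hpos
  · rw [hP.natDegree_eq_zero.1 (hd.trans h0), coeff_one]
    split_ifs <;> norm_num
  obtain ⟨w, hw⟩ : ∃ w : ℂ, aeval w P = 0 := by
    refine IsAlgClosed.exists_aeval_eq_zero ℂ P ?_
    rw [degree_eq_natDegree hP.ne_zero, hd]
    exact_mod_cast hpos.ne'
  have hre := h w hw
  by_cases him : w.im = 0
  · have hwr : w = (w.re : ℂ) := Complex.ext (by simp) (by simp [him])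
    refine step (X - C w.re) (monic_X_sub_C _) (by simp) (fun j => ?_) ?_
    · rcases j with _ | _ | j <;> simp [coeff_X, coeff_C, hre]
    · rw [dvd_iff_isRoot, IsRoot.def]
      rw [hwr] at hw
      have h2 : ((P.eval w.re : ℝ) : ℂ) = 0 := by
        rw [← hw]
        exact (aeval_algebraMap_apply ℂ w.re P).symm
      exact_mod_cast h2
  · have e : (X ^ 2 - C (2 * w.re) * X + C (‖w‖ ^ 2) : ℝ[X]) =
        C 1 * X ^ 2 + C (-(2 * w.re)) * X + C (‖w‖ ^ 2) := by
      simp only [C_neg, C_1]; ring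
    have hdvd := P.quadratic_dvd_of_aeval_eq_zero_im_ne_zero hw him
    rw [e] at hdvd
    have hdeg := natDegree_quadratic (R := ℝ) (a := 1) (b := -(2 * w.re)) (c := ‖w‖ ^ 2) one_ne_zero
    refine step _ ?_ (by omega) (fun j => ?_) hdvd
    · exact leadingCoeff_quadratic one_ne_zero
    · simp only [coeff_add, coeff_C_mul, coeff_X_pow, coeff_X, coeff_C]
      refine add_nonneg (add_nonneg ?_ (mul_nonneg (by linarith) ?_)) ?_ <;> split_ifs <;> positivity

/-! ### Necessity: a lower bound by convolution. -/

/-- If the Laplace transform of a nonnegative function is `b / A` with `A` monic of degree `n` and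
Hurwitz, then `modifiedEval n b` is positive on `[0, ∞)`. -/
theorem modifiedEval_pos_of_nonneg_impulse {b A : ℝ[X]} (hA : A.Monic)
    (hroots : ∀ w : ℂ, aeval w A = 0 → w.re < 0) (hb : b ≠ 0) (hbA : b.natDegree < A.natDegree)
    {h : ℝ → ℝ} {c : ℝ} (hc : 0 < c) (hcont : ContinuousOn h (Ici 0)) (hnn : ∀ t, 0 ≤ t → 0 ≤ h t)
    (hlap : ∀ s : ℂ, s.re = c →
      HasLaplaceAt h s (b.eval₂ Complex.ofRealHom s / A.eval₂ Complex.ofRealHom s))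
    {x : ℝ} (hx : 0 ≤ x) : 0 < modifiedEval A.natDegree b x := by
  set n := A.natDegree with hn
  set q := polyImpulse n A with hq
  have hAc : ∀ k, 0 ≤ A.coeff k :=
    coeff_nonneg_of_roots_re_nonpos hA fun w hw => (hroots w hw).le
  have hA0 : 0 < A.coeff 0 := by
    refine (hAc 0).lt_of_ne fun h0 => ?_
    have := hroots 0 (by rw [← coeff_zero_eq_aeval_zero' A, ← h0, map_zero])
    simp at this
  -- Only the term of `A.coeff 0` is kept; the others are nonnegative.
  obtain ⟨a, ha, hqa⟩ : ∃ a : ℝ, 0 < a ∧ ∀ t, 0 ≤ t → a * t ^ (n - 1) ≤ q t := by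
    refine ⟨A.coeff 0 / ((n - 1).factorial : ℝ), by positivity, fun t ht => ?_⟩
    have := Finset.single_le_sum (s := Finset.range n)
      (f := fun k => A.coeff k * (t ^ (n - 1 - k) / ((n - 1 - k).factorial : ℝ)))
      (fun k _ => mul_nonneg (hAc k) (by positivity)) (Finset.mem_range.2 (by omega : 0 < n))
    refine le_trans (le_of_eq ?_) this
    simp only [Nat.sub_zero]
    ring
  -- Constant extension to negative times gives continuity on all of `ℝ`.
  set h' : ℝ → ℝ := fun t => h (max t 0) with hh'
  have hh'c : Continuous h' :=
    hcont.comp_continuous (by fun_prop) fun t => mem_Ici.2 (le_max_right _ _)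
  have hh'n : ∀ t, 0 ≤ h' t := fun t => hnn _ (le_max_right _ _)
  have hh'e : ∀ t, 0 < t → h t = h' t := fun t ht => by simp [hh', max_eq_left ht.le]
  have hqc : Continuous q := continuous_polyImpulse n A
  set r : ℝ → ℝ := fun t => ∫ u in (0 : ℝ)..t, h' u * q (t - u) with hr
  have hrc : Continuous r := by
    refine intervalIntegral.continuous_parametric_intervalIntegral_of_continuous ?_ continuous_id
    fun_prop
  -- This is `b / sⁿ = b / A + (b / A) * (A / sⁿ - 1)` in the time domain.
  have key : ∀ t, 0 < t → polyImpulse n b t = h' t + r t := by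
    intro t ht
    rw [← sub_eq_zero]
    refine eq_zero_of_hasLaplaceAt_zero (c := c)
      (f := fun t => polyImpulse n b t - (h' t + r t)) ?_ (fun s hs => ?_) ht
    · have := continuous_polyImpulse n b
      fun_prop
    · have hs0 : 0 < s.re := hs ▸ hc
      have hsne : s ≠ 0 := by rintro rfl; simp at hs0
      have hAs : A.eval₂ Complex.ofRealHom s ≠ 0 := fun h0 => by
        have := hroots s h0
        linarith
      have h1 := (hlap s hs).congr hh'e
      have := (hasLaplaceAt_polyImpulse_of_natDegree_lt hs0 hbA).sub
        (h1.add (h1.convolution (hasLaplaceAt_polyImpulse_of_monic hs0 hA)))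
      convert this using 1
      rw [← hn]
      field_simp
      ring
  -- Otherwise `h'` vanishes on `[0, T]`, hence so does `polyImpulse n b` on `(0, T)` by `key`, and
  -- `b = 0`.
  have hI : ∀ T, 0 < T → 0 < ∫ u in (0 : ℝ)..T, h' u := by
    intro T hT
    by_contra hcon
    have hz : ∀ u ∈ Icc 0 T, h' u = 0 := by
      by_contra! hex
      obtain ⟨u, hu, hne⟩ := hex
      exact hcon (intervalIntegral.integral_pos hT hh'c.continuousOn (fun x _ => hh'n x)
        ⟨u, hu, (hh'n u).lt_of_ne hne.symm⟩)
    refine hb (eq_zero_of_polyImpulse_eq_zero hbA hT fun t ht => ?_)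
    rw [key t ht.1, hz t ⟨ht.1.le, ht.2.le⟩, zero_add, hr]
    refine (intervalIntegral.integral_congr (g := fun _ => 0) fun u hu => ?_).trans (by simp)
    rw [uIcc_of_le ht.1.le] at hu
    simp [hz u ⟨hu.1, hu.2.trans ht.2.le⟩]
  -- Discard `h' t` and the convolution over `[T, t]`; on `[0, T]` use `t - u ≥ t - T`.
  have lower : ∀ T t, 0 < T → T < t →
      a * (t - T) ^ (n - 1) * (∫ u in (0 : ℝ)..T, h' u) ≤ polyImpulse n b t := by
    intro T t hT hTt
    have hint : ∀ x y, IntervalIntegrable (fun u => h' u * q (t - u)) volume x y := fun x y =>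
      Continuous.intervalIntegrable (by fun_prop) _ _
    have hqn : ∀ u, u ≤ t → 0 ≤ q (t - u) := fun u hu =>
      le_trans (mul_nonneg ha.le (pow_nonneg (sub_nonneg.2 hu) _)) (hqa _ (sub_nonneg.2 hu))
    rw [key t (hT.trans hTt), ← intervalIntegral.integral_const_mul]
    have h1 : ∫ u in (0 : ℝ)..T, a * (t - T) ^ (n - 1) * h' u ≤
        ∫ u in (0 : ℝ)..T, h' u * q (t - u) := by
      refine intervalIntegral.integral_mono_on hT.le
        (Continuous.intervalIntegrable (by fun_prop) _ _) (hint _ _) fun u hu => ?_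
      rw [mul_comm (h' u)]
      refine mul_le_mul_of_nonneg_right (le_trans ?_ (hqa _ (by linarith [hu.2]))) (hh'n u)
      have := hu.2
      gcongr
    have h2 : 0 ≤ ∫ u in T..t, h' u * q (t - u) :=
      intervalIntegral.integral_nonneg hTt.le fun u hu => mul_nonneg (hh'n u) (hqn u hu.2)
    have h3 := intervalIntegral.integral_add_adjacent_intervals (hint 0 T) (hint T t)
    have h4 := hh'n t
    simp only [hr]
    linarith
  rcases hx.eq_or_lt with rfl | hx
  -- The value at `x = 0` is the limit `t = 1 / x → ∞` of `lower` with `T = 1`, rescaled by `x ^ (n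
  -- - 1)`; the bound stays positive in the limit.
  · have hlim : Filter.Tendsto (fun x : ℝ => a * (1 - x) ^ (n - 1) * ∫ u in (0 : ℝ)..1, h' u)
        (nhdsWithin 0 (Ioi 0)) (nhds (a * (1 - 0) ^ (n - 1) * ∫ u in (0 : ℝ)..1, h' u)) :=
      (Continuous.tendsto (by fun_prop) 0).mono_left nhdsWithin_le_nhds
    have hlim' := ((continuous_modifiedEval n b).tendsto 0).mono_left
      (nhdsWithin_le_nhds (s := Ioi (0 : ℝ)))
    refine lt_of_lt_of_le ?_ (le_of_tendsto_of_tendsto hlim hlim' ?_)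
    · have := hI 1 one_pos
      simp only [sub_zero, one_pow, mul_one]
      positivity
    · filter_upwards [Ioo_mem_nhdsGT (one_pos : (0 : ℝ) < 1)] with y hy
      rw [modifiedEval_eq_polyImpulse b hy.1.ne']
      have h1 := lower 1 y⁻¹ one_pos ((one_lt_inv₀ hy.1).2 hy.2)
      have h2 := mul_le_mul_of_nonneg_left h1 (pow_nonneg hy.1.le (n - 1))
      refine le_trans (le_of_eq ?_) h2
      have e : 1 - y = y * (y⁻¹ - 1) := by
        rw [mul_sub, mul_inv_cancel₀ hy.1.ne', mul_one]
      rw [e, mul_pow]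
      ring
  · rw [modifiedEval_eq_polyImpulse b hx.ne']
    have hx' : 0 < x⁻¹ := inv_pos.2 hx
    refine mul_pos (pow_pos hx _) (lt_of_lt_of_le ?_ (lower (x⁻¹ / 2) x⁻¹ (by linarith) (by linarith)))
    have := hI (x⁻¹ / 2) (by linarith)
    have h2 : 0 < x⁻¹ - x⁻¹ / 2 := by linarith
    positivity

/-! ### Sufficiency: openness of positivity. -/

theorem pos_of_continuous_of_ne_zero {F : ℝ → ℝ} (hF : Continuous F) {S : Set ℝ}
    (hS : S.OrdConnected) (h : ∀ x ∈ S, F x ≠ 0) {x₀ : ℝ} (hx₀ : x₀ ∈ S) (hpos : 0 < F x₀)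
    {x : ℝ} (hx : x ∈ S) : 0 < F x := by
  by_contra! hle
  obtain ⟨y, hy, hy0⟩ := hS.isPreconnected.intermediate_value hx hx₀ hF.continuousOn
    ⟨hle, hpos.le⟩
  exact h y hy hy0

/-- Reversal of `modifiedEval` for polynomials of degree at most `m`. -/
noncomputable def modifiedEvalReverse (m n : ℕ) (P : ℝ[X]) (y : ℝ) : ℝ :=
  ∑ k ∈ Finset.range (m + 1), P.coeff k * (y ^ (m - k) / ((n - 1 - k).factorial : ℝ))

theorem modifiedEvalReverse_eq {m n : ℕ} (hmn : m < n) {P : ℝ[X]} (hP : P.natDegree ≤ m) {y : ℝ}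
    (hy : y ≠ 0) : modifiedEvalReverse m n P y = y ^ m * modifiedEval n P y⁻¹ := by
  unfold modifiedEvalReverse modifiedEval
  rw [Finset.mul_sum]
  refine (Finset.sum_congr rfl fun k hk => ?_).trans
    (Finset.sum_subset (Finset.range_mono (by omega : m + 1 ≤ n)) fun k _ hk => ?_)
  · have hk' : m = k + (m - k) := by
      have := Finset.mem_range.1 hk
      omega
    have e : y ^ m = y ^ k * y ^ (m - k) := by rw [← pow_add, ← hk']
    rw [e, inv_pow]
    field_simp
  · rw [coeff_eq_zero_of_natDegree_lt (by simp only [Finset.mem_range] at hk; omega)]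
    ring

/-- Reversing in degree `m` rather than `n - 1` makes the value at `x = ∞` the leading coefficient
up to a positive factor when `P` has degree `m`. -/
theorem modifiedEvalReverse_zero (m n : ℕ) (P : ℝ[X]) :
    modifiedEvalReverse m n P 0 = P.coeff m / ((n - 1 - m).factorial : ℝ) := by
  unfold modifiedEvalReverse
  rw [Finset.sum_eq_single_of_mem m (by simp)]
  · simp [div_eq_mul_inv]
  · intro k hk hkm
    have := Finset.mem_range.1 hk
    rw [zero_pow (by omega)]
    ring

theorem polyImpulse_nonneg {n : ℕ} {P : ℝ[X]} (h : ∀ x, 0 ≤ x → 0 < modifiedEval n P x) {t : ℝ}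
    (ht : 0 ≤ t) : 0 ≤ polyImpulse n P t := by
  have hpos : ∀ t, 0 < t → 0 ≤ polyImpulse n P t := by
    intro t ht
    have := h t⁻¹ (inv_nonneg.2 ht.le)
    rw [modifiedEval_eq_polyImpulse P (inv_ne_zero ht.ne'), inv_inv] at this
    exact (pos_of_mul_pos_right this (by positivity)).le
  have hsub : Ici 0 ⊆ {t | 0 ≤ polyImpulse n P t} := by
    rw [← closure_Ioi]
    exact closure_minimal hpos (isClosed_le continuous_const (continuous_polyImpulse n P))
  exact hsub ht

theorem continuous_coeff_taylor (P : ℝ[X]) (k : ℕ) :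
    Continuous fun r : ℝ => (taylor r P).coeff k := by
  simp only [taylor_coeff]
  exact Polynomial.continuous _

/-- Positivity of `modifiedEval` on `[0, ∞)` persists under small shifts of the polynomial. -/
theorem eventually_modifiedEval_taylor_pos {m n : ℕ} (hmn : m < n) {b : ℝ[X]}
    (hdeg : b.natDegree = m) (hlead : 0 < b.leadingCoeff)
    (h : ∀ x, 0 ≤ x → modifiedEval n b x ≠ 0) :
    ∀ᶠ r in nhds (0 : ℝ), ∀ x, 0 ≤ x → 0 < modifiedEval n (taylor r b) x := by
  have hRc : Continuous (modifiedEvalReverse m n b) := by unfold modifiedEvalReverse; fun_prop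
  have hR0 : 0 < modifiedEvalReverse m n b 0 := by
    rw [modifiedEvalReverse_zero, ← hdeg]
    have : 0 < b.coeff b.natDegree := hlead
    positivity
  have hRpos : ∀ y, 0 ≤ y → 0 < modifiedEvalReverse m n b y := by
    intro y hy
    refine pos_of_continuous_of_ne_zero hRc ordConnected_Ici (fun y hy => ?_)
      (mem_Ici.2 le_rfl) hR0 (mem_Ici.2 hy)
    rcases (mem_Ici.1 hy).eq_or_lt with rfl | hy
    · exact hR0.ne'
    · rw [modifiedEvalReverse_eq hmn hdeg.le hy.ne']
      exact mul_ne_zero (pow_ne_zero _ hy.ne') (h _ (inv_nonneg.2 hy.le))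
  have hMpos : ∀ x, 0 ≤ x → 0 < modifiedEval n b x := by
    intro x hx
    refine pos_of_continuous_of_ne_zero (continuous_modifiedEval n b) ordConnected_Ici h
      (x₀ := 1) (mem_Ici.2 zero_le_one) ?_ (mem_Ici.2 hx)
    have := hRpos 1 zero_le_one
    rwa [modifiedEvalReverse_eq hmn hdeg.le one_ne_zero, one_pow, one_mul, inv_one] at this
  have c1 : Continuous fun p : ℝ × ℝ => modifiedEval n (taylor p.1 b) p.2 := by
    unfold modifiedEval
    have := fun k => (continuous_coeff_taylor b k).comp (continuous_fst (Y := ℝ))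
    simp only [Function.comp_def] at this
    fun_prop
  have c2 : Continuous fun p : ℝ × ℝ => modifiedEvalReverse m n (taylor p.1 b) p.2 := by
    unfold modifiedEvalReverse
    have := fun k => (continuous_coeff_taylor b k).comp (continuous_fst (Y := ℝ))
    simp only [Function.comp_def] at this
    fun_prop
  -- The charts `x ∈ [0, 1]` and `y = 1 / x ∈ [0, 1]` compactify `[0, ∞)`, so positivity is uniform
  -- in each.
  have e1 : ∀ᶠ r in nhds (0 : ℝ), ∀ x ∈ Icc (0 : ℝ) 1, 0 < modifiedEval n (taylor r b) x :=
    isCompact_Icc.eventually_forall_of_forall_eventually fun x hx =>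
      c1.continuousAt.eventually_const_lt (by simpa using hMpos x hx.1)
  have e2 : ∀ᶠ r in nhds (0 : ℝ), ∀ y ∈ Icc (0 : ℝ) 1, 0 < modifiedEvalReverse m n (taylor r b) y :=
    isCompact_Icc.eventually_forall_of_forall_eventually fun x hx =>
      c2.continuousAt.eventually_const_lt (by simpa using hRpos x hx.1)
  filter_upwards [e1, e2] with r h1 h2 x hx
  rcases le_or_gt x 1 with hx1 | hx1
  · exact h1 x ⟨hx, hx1⟩
  · have hx0 : 0 < x := one_pos.trans hx1
    have := h2 x⁻¹ ⟨inv_nonneg.2 hx, inv_le_one_of_one_le₀ hx1.le⟩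
    rw [modifiedEvalReverse_eq hmn (by rw [natDegree_taylor, hdeg]) (inv_ne_zero hx0.ne'),
      inv_inv] at this
    exact pos_of_mul_pos_right this (by positivity)

/-! ### The shifted numerator as a real polynomial. -/

theorem exists_real_of_map_conj_eq {P : ℂ[X]} (h : P.map (starRingEnd ℂ) = P) :
    ∃ Q : ℝ[X], Q.map Complex.ofRealHom = P := by
  have : P ∈ lifts Complex.ofRealHom := by
    rw [lifts_iff_coeff_lifts]
    intro k
    have hk : (starRingEnd ℂ) (P.coeff k) = P.coeff k := by rw [← coeff_map, h]
    obtain ⟨r, hr⟩ := Complex.conj_eq_iff_real.1 hk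
    exact ⟨r, hr.symm⟩
  exact this

theorem shiftedNumerator_map_conj {m : ℕ} (K : ℝ) {z : Fin m → ℂ} (hz : ConjClosed z) (α : ℝ) :
    (shiftedNumerator K z α).map (starRingEnd ℂ) = shiftedNumerator K z α := by
  obtain ⟨e, he⟩ := hz
  unfold shiftedNumerator
  simp only [Polynomial.map_mul, Polynomial.map_prod, Polynomial.map_sub, map_C, map_X,
    Complex.conj_ofReal, ← he]
  congr 1
  exact Equiv.prod_comp e fun i => X - C (z i) - C (α : ℂ)

theorem shiftedNumerator_eval {m : ℕ} (K : ℝ) (z : Fin m → ℂ) (α : ℝ) (s : ℂ) :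
    (shiftedNumerator K z α).eval s = K * ∏ i, (s - α - z i) := by
  simp only [shiftedNumerator, eval_mul, eval_C, eval_prod, eval_sub, eval_X]
  congr 1
  exact Finset.prod_congr rfl fun i _ => by ring

theorem shiftedNumerator_eq_C_mul_prod {m : ℕ} (K : ℝ) (z : Fin m → ℂ) (α : ℝ) :
    shiftedNumerator K z α = C (K : ℂ) * ∏ i, (X - C (z i + α)) := by
  unfold shiftedNumerator
  congr 1
  exact Finset.prod_congr rfl fun i _ => by rw [C_add]; ring

theorem natDegree_shiftedNumerator {m : ℕ} {K : ℝ} (hK : 0 < K) (z : Fin m → ℂ) (α : ℝ) :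
    (shiftedNumerator K z α).natDegree = m := by
  rw [shiftedNumerator_eq_C_mul_prod, natDegree_C_mul (by exact_mod_cast hK.ne'),
    natDegree_prod_of_monic _ _ fun i _ => monic_X_sub_C _]
  simp only [natDegree_X_sub_C, Finset.sum_const, Finset.card_univ, Fintype.card_fin, smul_eq_mul,
    mul_one]

theorem leadingCoeff_shiftedNumerator {m : ℕ} (K : ℝ) (z : Fin m → ℂ) (α : ℝ) :
    (shiftedNumerator K z α).leadingCoeff = K := by
  rw [shiftedNumerator_eq_C_mul_prod, leadingCoeff_mul,
    (monic_prod_of_monic _ _ fun i _ => monic_X_sub_C _).leadingCoeff]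
  simp

theorem natDegree_and_leadingCoeff_of_map_eq {m : ℕ} {K : ℝ} (hK : 0 < K) {z : Fin m → ℂ} {α : ℝ}
    {b : ℝ[X]} (hb : b.map Complex.ofRealHom = shiftedNumerator K z α) :
    b.natDegree = m ∧ b.leadingCoeff = K := by
  constructor
  · rw [← natDegree_shiftedNumerator hK z α, ← hb, natDegree_map]
  · have := leadingCoeff_shiftedNumerator K z α
    rw [← hb, leadingCoeff_map] at this
    exact Complex.ofReal_injective this

/-! ### The two implications for the transfer function. -/

/-- All poles are placed at `r - α` with `r < 0` small: `r < 0` makes the decay strict, and `b(r) ≠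
0` excludes cancellation. The latter holds near `0` because the root condition at `x = 0` says `b(0)
≠ 0`. -/
theorem exists_noCancellation_solution {m n : ℕ} (hmn : m < n) {K : ℝ} (hK : 0 < K)
    {z : Fin m → ℂ} {α : ℝ} (hα : 0 ≤ α) {b : ℝ[X]}
    (hb : b.map Complex.ofRealHom = shiftedNumerator K z α)
    (h : ∀ x, 0 ≤ x → modifiedEval n b x ≠ 0) :
    ∃ p : Fin n → ℂ, NoCancellation z p ∧ IsSolution K z p ∧ decayRate p < -α := by
  obtain ⟨hdeg, hlead⟩ := natDegree_and_leadingCoeff_of_map_eq hK hb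
  have hb0 : b.eval 0 ≠ 0 := by
    have := h 0 le_rfl
    rw [modifiedEval_zero (by omega)] at this
    rw [← coeff_zero_eq_eval_zero]
    exact fun h0 => this (by simp [h0])
  have hev := (eventually_modifiedEval_taylor_pos hmn hdeg (hlead ▸ hK) h).and
    (b.continuous.continuousAt.eventually_ne hb0)
  obtain ⟨r, hr, hpos, hne⟩ : ∃ r : ℝ, r < 0 ∧ (∀ x, 0 ≤ x → 0 < modifiedEval n (taylor r b) x) ∧
      b.eval r ≠ 0 := by
    obtain ⟨r, hr1, hr2⟩ := ((hev.filter_mono nhdsWithin_le_nhds).and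
      (self_mem_nhdsWithin (s := Iio (0 : ℝ)) (a := 0))).exists
    exact ⟨r, hr2, hr1⟩
  have : Nonempty (Fin n) := ⟨⟨0, by omega⟩⟩
  refine ⟨fun _ => ((r - α : ℝ) : ℂ), ?_, ⟨?_, ?_⟩, ?_⟩
  · intro _ j hj
    refine hne ?_
    have h1 : (shiftedNumerator K z α).eval (r : ℂ) = 0 := by
      rw [shiftedNumerator_eval, Finset.prod_eq_zero (Finset.mem_univ j), mul_zero]
      rw [← hj]
      push_cast; ring
    rw [← hb, eval_map, ← Complex.ofRealHom_eq_coe, eval₂_at_apply] at h1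
    exact Complex.ofReal_injective h1
  · intro i
    simp only [Complex.ofReal_re]
    linarith
  · refine ⟨fun t => Real.exp ((r - α) * t) * polyImpulse n (taylor r b) t, ⟨?_, 0, ?_⟩, ?_⟩
    · have := continuous_polyImpulse n (taylor r b)
      fun_prop
    · intro s hs
      have hs' : 0 < (s - (r - α : ℝ)).re := by
        simp only [Complex.sub_re, Complex.ofReal_re]
        linarith
      have h1 := (hasLaplaceAt_polyImpulse_of_natDegree_lt hs'
        (P := taylor r b) (by rw [natDegree_taylor, hdeg]; exact hmn)).exp_mul (r - α)
      rw [sub_add_cancel] at h1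
      -- In the variable centred at the pole, the numerator of `H` is `b` translated by `r`.
      have e : (taylor r b).eval₂ Complex.ofRealHom (s - (r - α : ℝ)) = K * ∏ i, (s - z i) := by
        rw [taylor_apply, eval₂_comp, ← eval_map Complex.ofRealHom, hb, shiftedNumerator_eval]
        congr 1
        refine Finset.prod_congr rfl fun i _ => ?_
        simp only [eval₂_add, eval₂_X, eval₂_C, Complex.ofRealHom_eq_coe]
        push_cast; ring
      rw [e] at h1
      simpa [transferFunction, HasLaplaceAt] using h1
    · intro t ht
      exact mul_nonneg (Real.exp_pos _).le (polyImpulse_nonneg hpos ht)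
  · simp only [decayRate, Complex.ofReal_re, ciSup_const]
    linarith

theorem modifiedEval_pos_of_isSolution {m n : ℕ} (hmn : m < n) {K : ℝ} (hK : 0 < K)
    {z : Fin m → ℂ} {α : ℝ} {b : ℝ[X]}
    (hb : b.map Complex.ofRealHom = shiftedNumerator K z α)
    {p : Fin n → ℂ} (hp : IsSolution K z p) (hdec : decayRate p < -α) {x : ℝ} (hx : 0 ≤ x) :
    0 < modifiedEval n b x := by
  obtain ⟨-, h, ⟨hcont, c, hlap⟩, hnn⟩ := hp
  have hpre : ∀ i, (p i).re < -α := fun i =>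
    (le_ciSup (Set.finite_range fun i => (p i).re).bddAbove i).trans_lt hdec
  obtain ⟨hdeg, hlead⟩ := natDegree_and_leadingCoeff_of_map_eq hK hb
  have hbne : b ≠ 0 := by
    rintro rfl
    simp at hlead
    exact hK.ne hlead
  set h' : ℝ → ℝ := fun t => Real.exp (α * t) * h t with hh'
  set A' : ℂ[X] := ∏ i, (X - C (p i + α)) with hA'
  have hA'm : A'.Monic := monic_prod_of_monic _ _ fun i _ => monic_X_sub_C _
  have hA'd : A'.natDegree = n := by
    rw [hA', natDegree_prod_of_monic _ _ fun i _ => monic_X_sub_C _]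
    simp only [natDegree_X_sub_C, Finset.sum_const, Finset.card_univ, Fintype.card_fin, smul_eq_mul,
      mul_one]
  have hA'e : ∀ s, A'.eval s = ∏ i, (s - α - p i) := by
    intro s
    simp only [hA', eval_prod, eval_sub, eval_X, eval_C]
    exact Finset.prod_congr rfl fun i _ => by ring
  have hA'r : ∀ w, A'.eval w = 0 → w.re < 0 := by
    intro w hw
    rw [hA'e, Finset.prod_eq_zero_iff] at hw
    obtain ⟨i, -, hi⟩ := hw
    have h1 := congrArg Complex.re hi
    simp only [Complex.sub_re, Complex.ofReal_re, Complex.zero_re] at h1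
    linarith [hpre i]
  have hlap' : ∀ s : ℂ, c + α < s.re →
      HasLaplaceAt h' s (b.eval₂ Complex.ofRealHom s / A'.eval s) := by
    intro s hs
    have h1 : HasLaplaceAt h (s - α) (transferFunction K z p (s - α)) :=
      hlap (s - α) (by simp only [Complex.sub_re, Complex.ofReal_re]; linarith)
    have h2 := h1.exp_mul α
    rw [sub_add_cancel] at h2
    rw [← eval_map, hb, shiftedNumerator_eval, hA'e]
    exact h2
  -- The poles are not assumed conjugation-closed; this follows from `h` being real. At large real
  -- `t`, `b(t) / A'(t)` is a real Laplace integral, so `A'(t)` is real wherever `b(t) ≠ 0`.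
  have hconj : A'.map (starRingEnd ℂ) = A' := by
    refine eq_of_infinite_eval_eq _ _ ?_
    have hfin : {t : ℝ | b.IsRoot t}.Finite := finite_setOfPred_isRoot hbne
    have hinf : (Ioi (max (c + α) 0) \ {t : ℝ | b.IsRoot t}).Infinite :=
      (Ioi_infinite _).sdiff hfin
    refine (hinf.image Complex.ofReal_injective.injOn).mono ?_
    rintro _ ⟨t, ⟨ht, htb⟩, rfl⟩
    have ht1 : c + α < t := (le_max_left _ _).trans_lt ht
    have ht0 : 0 < t := (le_max_right _ _).trans_lt ht
    have hAt : A'.eval (t : ℂ) ≠ 0 := fun h0 => by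
      have := hA'r _ h0
      simp only [Complex.ofReal_re] at this
      linarith
    have hbt : b.eval₂ Complex.ofRealHom (t : ℂ) = ((b.eval t : ℝ) : ℂ) :=
      eval₂_at_apply Complex.ofRealHom t
    have hbt0 : ((b.eval t : ℝ) : ℂ) ≠ 0 := by exact_mod_cast htb
    have hv := (hlap' t (by simpa using ht1)).2
    rw [hbt] at hv
    have hreal : (starRingEnd ℂ) (((b.eval t : ℝ) : ℂ) / A'.eval (t : ℂ)) =
        ((b.eval t : ℝ) : ℂ) / A'.eval (t : ℂ) := by
      rw [← hv, ← integral_conj]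
      congr 1
      funext u
      rw [map_mul, ← Complex.exp_conj]
      simp
    rw [map_div₀, Complex.conj_ofReal] at hreal
    have hAt' : (starRingEnd ℂ) (A'.eval (t : ℂ)) ≠ 0 := by simpa using hAt
    rw [div_eq_div_iff hAt' hAt] at hreal
    have h3 := mul_left_cancel₀ hbt0 hreal
    have h4 := eval_map_apply (f := starRingEnd ℂ) (p := A') (t : ℂ)
    rw [Complex.conj_ofReal] at h4
    exact h4.trans h3.symm
  obtain ⟨A, hA⟩ := exists_real_of_map_conj_eq hconj
  have hAm : A.Monic := monic_of_injective Complex.ofRealHom.injective (hA ▸ hA'm)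
  have hAd : A.natDegree = n := by rw [← hA'd, ← hA, natDegree_map]
  have hAe : ∀ s, A.eval₂ Complex.ofRealHom s = A'.eval s := fun s => by rw [← hA, eval_map]
  -- The abscissa `max (c + α) 0 + 1` lies both where the integral of `h'` converges and in the
  -- right half-plane needed for `1 / sⁿ`.
  have := modifiedEval_pos_of_nonneg_impulse (b := b) hAm (fun w hw => hA'r w ((hAe w).symm.trans hw)) hbne
    (by omega) (h := h') (c := max (c + α) 0 + 1)
    (by have := le_max_right (c + α) 0; linarith) (by fun_prop)
    (fun t ht => mul_nonneg (Real.exp_pos _).le (hnn t ht))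
    (fun s hs => by
      rw [hAe]
      exact hlap' s (by have := le_max_left (c + α) 0; linarith)) hx
  rwa [hAd] at this

end MonotonicTracking

/-- The first equivalence asks for poles without zero-pole cancellations, the second one allows
cancellations. -/
theorem mainTheorem3 {m n : ℕ} (hmn : m < n) (K : ℝ) (hK : 0 < K)
    (z : Fin m → ℂ) (hz : MonotonicTracking.ConjClosed z) (α : ℝ) (hα : 0 ≤ α) :
    ((∃ p : Fin n → ℂ, MonotonicTracking.NoCancellation z p ∧
        MonotonicTracking.IsSolution K z p ∧ MonotonicTracking.decayRate p < -α) ↔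
      ¬ MonotonicTracking.HasNonnegRealRoot
        (MonotonicTracking.modifiedPolynomial n (MonotonicTracking.shiftedNumerator K z α))) ∧
    ((∃ p : Fin n → ℂ,
        MonotonicTracking.IsSolution K z p ∧ MonotonicTracking.decayRate p < -α) ↔
      ¬ MonotonicTracking.HasNonnegRealRoot
        (MonotonicTracking.modifiedPolynomial n (MonotonicTracking.shiftedNumerator K z α))) := by
  obtain ⟨b, hb⟩ := MonotonicTracking.exists_real_of_map_conj_eq
    (MonotonicTracking.shiftedNumerator_map_conj K hz α)
  rw [← hb, MonotonicTracking.hasNonnegRealRoot_modifiedPolynomial_iff]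
  have necessity : ∀ p : Fin n → ℂ, MonotonicTracking.IsSolution K z p →
      MonotonicTracking.decayRate p < -α →
      ¬ ∃ x : ℝ, 0 ≤ x ∧ MonotonicTracking.modifiedEval n b x = 0 := by
    rintro p hp hdec ⟨x, hx, hx0⟩
    exact (MonotonicTracking.modifiedEval_pos_of_isSolution hmn hK hb hp hdec hx).ne' hx0
  have sufficiency : (¬ ∃ x : ℝ, 0 ≤ x ∧ MonotonicTracking.modifiedEval n b x = 0) →
      ∃ p : Fin n → ℂ, MonotonicTracking.NoCancellation z p ∧
        MonotonicTracking.IsSolution K z p ∧ MonotonicTracking.decayRate p < -α := fun h =>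
    MonotonicTracking.exists_noCancellation_solution hmn hK hα hb
      fun x hx hx0 => h ⟨x, hx, hx0⟩
  refine ⟨⟨?_, sufficiency⟩, ⟨?_, fun h => ?_⟩⟩
  · rintro ⟨p, -, hp, hdec⟩
    exact necessity p hp hdec
  · rintro ⟨p, hp, hdec⟩
    exact necessity p hp hdec
  · obtain ⟨p, -, hp⟩ := sufficiency h
    exact ⟨p, hp⟩
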